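/- Conventions. A simplicial complex on a finite vertex set $V$ is a family of subsets of $V$, called faces, that is closed under taking subsets and contains $\{v\}$ for every $v\in V$. The dimension of a face $E$ is $|E|-1$. Facets are inclusion-maximal faces, and a complex is pure of dimension $d$ if all its facets have dimension $d$. It is strongly connected if its dual graph is connected; the nodes of this graph are the facets, and two distinct facets are adjacent when they share a face of codimension one. For sets $F_1,\dots,F_k$, let $\langle F_1,\dots,F_k\rangle$ denote the complex of all subsets of the $F_i$. The $d$-skeleton of the simplex on $V$ is the complex of all subsets of $V$ of dimension at most $d$. Let $\Delta$ be a pure $d$-dimensional simplicial complex with vertex set $[n]=\{1,\dots,n\}$. The natural order on $[n]$ is a unit interval order for $\Delta$ if, for every facet $\{v_0<v_1<\dots<v_d\}$ of $\Delta$, every subset of $\{v_0,v_0+1,\dots,v_d\}$ of dimension at most $d$ is a face of $\Delta$. A shelling of a pure $d$-dimensional complex is an ordering $F_1,\dots,F_m$ of all its facets (each listed once) such that, for every $1\le k<m$, the complex $\langle F_{k+1}\rangle\cap\langle F_1,\dots,F_k\rangle$ is pure of dimension $d-1$. A pure $d$-dimensional complex with vertex set $[n]$ is shelling completable if some shelling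 of it is an initial segment of some shelling of the $d$-skeleton of the simplex on $[n]$. **Corollary 4.5.** Let $d$ and $n$ be positive integers with $d<n$, and let $\Delta$ be a pure, strongly connected, $d$-dimensional simplicial complex with vertex set $[n]$, such that the natural order on $[n]$ is a unit interval order for $\Delta$. Then $\Delta$ is shelling completable. -/

import Mathlib

/-- The dimension `|E| - 1` of a face. -/
def faceDim {V : Type*} (E : Finset V) : ℤ := (E.card : ℤ) - 1

namespace PreAbstractSimplicialComplex

variable {V : Type*}

/-- A facet is a face that is maximal under inclusion. -/
def IsFacet (K : PreAbstractSimplicialComplex V) (F : Finset V) : Prop :=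
  Maximal (fun E => E ∈ K) F

/-- `K` is pure of dimension `d`: it has a facet, and all its facets have dimension `d`. -/
def IsPureOfDim (K : PreAbstractSimplicialComplex V) (d : ℤ) : Prop :=
  (∃ F, K.IsFacet F) ∧ ∀ F, K.IsFacet F → faceDim F = d

/-- The dual graph: its nodes are the facets, and two distinct facets are adjacent if and only if
they share a face of codimension one. -/
def dualGraph (K : PreAbstractSimplicialComplex V) : SimpleGraph {F : Finset V // K.IsFacet F} where
  Adj F G := F ≠ G ∧ ∃ E ∈ K, E ⊆ F.1 ∧ E ⊆ G.1 ∧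
    faceDim E = faceDim F.1 - 1 ∧ faceDim E = faceDim G.1 - 1
  symm := ⟨fun _ _ ⟨hne, E, hE, hF, hG, hdF, hdG⟩ => ⟨hne.symm, E, hE, hG, hF, hdG, hdF⟩⟩
  loopless := ⟨fun _ h => h.1 rfl⟩

/-- A (pure) complex is strongly connected if its dual graph is connected. -/
def IsStronglyConnected (K : PreAbstractSimplicialComplex V) : Prop :=
  K.dualGraph.Connected

/-- The complex `⟨F₁, …, Fₖ⟩` generated by a collection of sets. -/
def generatedBy (S : Set (Finset V)) : PreAbstractSimplicialComplex V where
  faces := {E | E.Nonempty ∧ ∃ F ∈ S, E ⊆ F}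
  isRelLowerSet_faces := fun _ hE =>
    ⟨hE.1, fun _ hle hne => ⟨hne, hE.2.imp fun _ hF => ⟨hF.1, hle.trans hF.2⟩⟩⟩

/-- The `d`-skeleton of the full simplex with vertex set `V`. -/
def simplexSkeleton (V : Type*) (d : ℤ) : PreAbstractSimplicialComplex V where
  faces := {E | E.Nonempty ∧ faceDim E ≤ d}
  isRelLowerSet_faces := fun _ hE => ⟨hE.1, fun _ hle hne => ⟨hne, by
    have hcard := Finset.card_le_card hle
    have hdim := hE.2
    unfold faceDim at *
    omega⟩⟩

/-- For a complex with linearly ordered vertices, pure of dimension `d`, the order is a unit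
interval order if, for each facet `F` with least vertex `v₀` and greatest vertex `v_d`, the complex
contains every nonempty set `E` of dimension at most `d` of vertices lying between `v₀` and `v_d`
(equivalently, each lying between two vertices of `F`). -/
def IsUnitIntervalOrder [LinearOrder V] (K : PreAbstractSimplicialComplex V) (d : ℤ) : Prop :=
  K.IsPureOfDim d ∧ ∀ F, K.IsFacet F → ∀ E : Finset V, E.Nonempty → faceDim E ≤ d →
    (∀ x ∈ E, ∃ a ∈ F, ∃ b ∈ F, a ≤ x ∧ x ≤ b) → E ∈ K

/-- The list `l = [F₁, …, F_m]` is a shelling of the pure `d`-dimensional complex `K`: it lists every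
facet of `K` exactly once, and for each member after the first, the intersection of the
complex it generates with the complex generated by its predecessors is pure of
dimension `d - 1`. -/
def IsShelling (K : PreAbstractSimplicialComplex V) (d : ℤ) (l : List (Finset V)) : Prop :=
  K.IsPureOfDim d ∧ l.Nodup ∧ (∀ F, F ∈ l ↔ K.IsFacet F) ∧
    ∀ (k : ℕ) (hk : k < l.length), 0 < k →
      (generatedBy {l[k]} ⊓ generatedBy {F | F ∈ l.take k}).IsPureOfDim (d - 1)

/-- The pure `d`-dimensional complex `K` with vertex set `V` is shelling completable: some shelling
of `K` is an initial segment of a shelling of the `d`-skeleton of the simplex on `V`. -/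
def IsShellingCompletable (K : PreAbstractSimplicialComplex V) (d : ℤ) : Prop :=
  ∃ l l' : List (Finset V), K.IsShelling d l ∧ (simplexSkeleton V d).IsShelling d (l ++ l')

end PreAbstractSimplicialComplex

/-! Order all `(d+1)`-sets with those of `K` first, then by size of the interval they span, then
colexicographically. If `G` precedes `F`, some `x ∈ F \ G` can be exchanged for a new vertex to give
a set still before `F` (`exists_exchange`); this is the shelling condition. The new set spans no
more than `F`, so the unit interval property keeps it in `K` when `F` is; one order thus shells both
`K` and the skeleton. The exception is an `F` that is itself an interval: it must be shifted left.
Strong connectivity puts all such intervals in `K` (`mem_of_ordHull_eq`). -/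

theorem exists_list_pairwise_lt {α β : Type*} [LinearOrder β] (s : Finset α) {f : α → β}
    (hf : Function.Injective f) :
    ∃ l : List α, (∀ x, x ∈ l ↔ x ∈ s) ∧ l.Pairwise fun x y => f x < f y := by
  let := LinearOrder.lift' f hf
  refine ⟨s.sort (· ≤ ·), fun x => Finset.mem_sort _, ?_⟩
  refine ((Finset.pairwise_sort s (· ≤ ·)).and (Finset.sort_nodup s (· ≤ ·))).imp ?_
  rintro a b ⟨h, hne⟩
  exact lt_of_le_of_ne h fun e => hne (hf e)

/-- The set of all elements lying between two elements of `F`. -/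
def ordHull {n : ℕ} (F : Finset (Fin n)) : Finset (Fin n) :=
  {x | ∃ a ∈ F, ∃ b ∈ F, a ≤ x ∧ x ≤ b}

theorem mem_ordHull {n : ℕ} {F : Finset (Fin n)} {x : Fin n} :
    x ∈ ordHull F ↔ ∃ a ∈ F, ∃ b ∈ F, a ≤ x ∧ x ≤ b := by
  simp [ordHull]

theorem subset_ordHull {n : ℕ} (F : Finset (Fin n)) : F ⊆ ordHull F :=
  fun x hx => mem_ordHull.2 ⟨x, hx, x, hx, le_rfl, le_rfl⟩

theorem ordHull_subset {n : ℕ} {F G : Finset (Fin n)} (h : F ⊆ ordHull G) :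
    ordHull F ⊆ ordHull G := by
  intro x hx
  obtain ⟨a, ha, b, hb, hax, hxb⟩ := mem_ordHull.1 hx
  obtain ⟨p, hp, -, -, hpa, -⟩ := mem_ordHull.1 (h ha)
  obtain ⟨-, -, q, hq, -, hbq⟩ := mem_ordHull.1 (h hb)
  exact mem_ordHull.2 ⟨p, hp, q, hq, hpa.trans hax, hxb.trans hbq⟩

theorem ordHull_eq_Icc {n : ℕ} {F : Finset (Fin n)} (hF : F.Nonempty) :
    ordHull F = Finset.Icc (F.min' hF) (F.max' hF) := by
  ext x
  rw [mem_ordHull, Finset.mem_Icc]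
  constructor
  · rintro ⟨a, ha, b, hb, hax, hxb⟩
    exact ⟨(F.min'_le a ha).trans hax, hxb.trans (F.le_max' b hb)⟩
  · rintro ⟨h1, h2⟩
    exact ⟨_, F.min'_mem hF, _, F.max'_mem hF, h1, h2⟩

namespace PreAbstractSimplicialComplex

/-! ### Pure complexes and an exchange criterion for shellings. -/

section Pure

variable {V : Type*} [Finite V] {K : PreAbstractSimplicialComplex V} {d : ℕ}

theorem exists_isFacet_of_mem {E : Finset V} (hE : E ∈ K) : ∃ F, E ⊆ F ∧ K.IsFacet F :=
  (Set.toFinite {E : Finset V | E ∈ K}).exists_le_maximal hE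

theorem IsPureOfDim.isFacet_iff (hK : K.IsPureOfDim d) {F : Finset V} :
    K.IsFacet F ↔ F ∈ K ∧ F.card = d + 1 := by
  have hcard : ∀ G, K.IsFacet G → G.card = d + 1 := fun G hG => by
    have := hK.2 G hG
    unfold faceDim at this
    omega
  refine ⟨fun h => ⟨h.1, hcard F h⟩, fun ⟨hF, hc⟩ => ?_⟩
  obtain ⟨G, hFG, hG⟩ := exists_isFacet_of_mem hF
  rwa [Finset.eq_of_subset_of_card_le hFG (by rw [hcard G hG, hc])]

theorem isPureOfDim_simplexSkeleton {F : Finset V} (hF : F.card = d + 1) :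
    (simplexSkeleton V d).IsPureOfDim d := by
  classical
  have := Fintype.ofFinite V
  have key : ∀ G, (simplexSkeleton V d).IsFacet G → faceDim G = d := by
    intro G hG
    have h1 : faceDim G ≤ d := hG.1.2
    by_contra hne
    have hlt : G.card < F.card := by unfold faceDim at *; omega
    obtain ⟨x, -, hx⟩ := Finset.exists_mem_notMem_of_card_lt_card hlt
    have hmem : insert x G ∈ simplexSkeleton V d := by
      refine ⟨Finset.insert_nonempty _ _, ?_⟩
      unfold faceDim
      rw [Finset.card_insert_of_notMem hx]
      push_cast
      omega
    exact hx (hG.2 hmem (Finset.subset_insert x G) (Finset.mem_insert_self x G))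
  refine ⟨?_, key⟩
  have hFm : F ∈ simplexSkeleton V d :=
    ⟨Finset.card_pos.1 (by omega), by unfold faceDim; omega⟩
  obtain ⟨G, -, hG⟩ := exists_isFacet_of_mem hFm
  exact ⟨G, hG⟩

/-- A face of `F` shared with an earlier `G` misses the exchanged vertex `x`, so it lies in `F.erase
x`, which is itself in the intersection. Since `0 < d`, this set is nonempty, hence a genuine face.
-/
theorem isShelling_of_pairwise_lt [DecidableEq V] {β : Type*} [Preorder β] {f : Finset V → β}
    (hd : 0 < d) (hK : K.IsPureOfDim d) {l : List (Finset V)}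
    (hmem : ∀ F, F ∈ l ↔ F ∈ K ∧ F.card = d + 1) (hl : l.Pairwise fun F G => f F < f G)
    (hex : ∀ F ∈ l, ∀ G ∈ l, f G < f F →
      ∃ x ∈ F, x ∉ G ∧ ∃ H ∈ l, f H < f F ∧ F.erase x ⊆ H) :
    K.IsShelling d l := by
  refine ⟨hK, hl.imp (fun {A B} h (e : A = B) => lt_irrefl (f A) (by rwa [← e] at h)), fun F => (hmem F).trans hK.isFacet_iff.symm,
    fun k hk hk0 => ?_⟩
  have hbefore : ∀ G, G ∈ l.take k ↔ G ∈ l ∧ f G < f l[k] := by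
    intro G
    rw [List.mem_take_iff_getElem]
    constructor
    · rintro ⟨i, hi, rfl⟩
      exact ⟨List.getElem_mem _, List.pairwise_iff_getElem.1 hl _ _ _ hk (by omega)⟩
    · rintro ⟨hG, hlt⟩
      obtain ⟨i, hi, rfl⟩ := List.getElem_of_mem hG
      refine ⟨i, ?_, rfl⟩
      by_contra hik
      rcases (show k ≤ i by omega).eq_or_lt with h | h
      · subst h
        exact lt_irrefl _ hlt
      · exact lt_asymm hlt (List.pairwise_iff_getElem.1 hl _ _ hk hi h)
  set F := l[k] with hFdef
  have hFl : F ∈ l := List.getElem_mem _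
  have hFc : F.card = d + 1 := ((hmem F).1 hFl).2
  set X := generatedBy {F} ⊓ generatedBy {G | G ∈ l.take k} with hX
  have hXmem : ∀ E, E ∈ X ↔ E.Nonempty ∧ E ⊆ F ∧ ∃ G ∈ l, f G < f F ∧ E ⊆ G := by
    intro E
    constructor
    · rintro ⟨⟨h1, _, rfl, h2⟩, -, G, hG, h3⟩
      obtain ⟨hGl, hlt⟩ := (hbefore G).1 hG
      exact ⟨h1, h2, G, hGl, hlt, h3⟩
    · rintro ⟨h1, h2, G, hGl, hlt, h3⟩
      exact ⟨⟨h1, F, rfl, h2⟩, h1, G, (hbefore G).2 ⟨hGl, hlt⟩, h3⟩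
  have hext : ∀ E ∈ X, ∃ x ∈ F, E ⊆ F.erase x ∧ F.erase x ∈ X := by
    intro E hE
    obtain ⟨-, h2, G, hGl, hlt, h3⟩ := (hXmem E).1 hE
    obtain ⟨x, hxF, hxG, H, hH, hHlt, hsub⟩ := hex F hFl G hGl hlt
    refine ⟨x, hxF, fun y hy => Finset.mem_erase.2 ⟨fun e => hxG (e ▸ h3 hy), h2 hy⟩,
      (hXmem _).2 ⟨Finset.card_pos.1 ?_, Finset.erase_subset _ _, H, hH, hHlt, hsub⟩⟩
    rw [Finset.card_erase_of_mem hxF]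
    omega
  constructor
  · have h0 : 0 < l.length := by omega
    obtain ⟨x, hxF, hxG, H, hH, hHlt, hsub⟩ := hex F hFl l[0] (List.getElem_mem _)
      (List.pairwise_iff_getElem.1 hl _ _ h0 hk hk0)
    have hX1 : F.erase x ∈ X := by
      refine (hXmem _).2 ⟨Finset.card_pos.1 ?_, Finset.erase_subset _ _, H, hH, hHlt, hsub⟩
      rw [Finset.card_erase_of_mem hxF]
      omega
    obtain ⟨E, -, hE⟩ := exists_isFacet_of_mem hX1
    exact ⟨E, hE⟩
  · intro E hE
    obtain ⟨x, hxF, hsub, hmem'⟩ := hext E hE.1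
    have : E = F.erase x := Finset.Subset.antisymm hsub (hE.2 hmem' hsub)
    rw [this, faceDim, Finset.card_erase_of_mem hxF, hFc]
    simp

end Pure

/-! ### Intervals, the sorting key and exchanges. -/

section UnitInterval

variable {n d : ℕ} {K : PreAbstractSimplicialComplex (Fin n)}

theorem IsUnitIntervalOrder.mem_of_subset_ordHull (hK : K.IsUnitIntervalOrder d)
    {F H : Finset (Fin n)} (hF : F ∈ K) (hFc : F.card = d + 1) (hHc : H.card = d + 1)
    (h : H ⊆ ordHull F) : H ∈ K :=
  hK.2 F (hK.1.isFacet_iff.2 ⟨hF, hFc⟩) H (Finset.card_pos.1 (by omega))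
    (by unfold faceDim; omega) fun _ hx => mem_ordHull.1 (h hx)

/-- In a strongly connected complex with a unit interval order, every set of `d + 1` consecutive
vertices is a face. -/
theorem IsUnitIntervalOrder.mem_of_ordHull_eq (hd : 0 < d) (hK : K.IsUnitIntervalOrder d)
    (hconn : K.IsStronglyConnected) (hvert : ∀ v, {v} ∈ K) {H : Finset (Fin n)}
    (hHc : H.card = d + 1) (hH : ordHull H = H) : H ∈ K := by
  by_contra hHK
  have hne : H.Nonempty := Finset.card_pos.1 (by omega)
  set c := H.min' hne
  set e := H.max' hne
  have hIcc : H = Finset.Icc c e := hH.symm.trans (ordHull_eq_Icc hne)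
  have hce : c < e := Finset.min'_lt_max'_of_card H (by omega)
  -- A facet reaching both down to `c` and up to `e` would force `H` into `K`.
  have hside : ∀ F, K.IsFacet F → (∀ x ∈ F, x < e) ∨ ∀ x ∈ F, c < x := by
    intro F hF
    by_contra! hcon
    obtain ⟨⟨p, hp, hep⟩, q, hq, hqc⟩ := hcon
    obtain ⟨hFK, hFc⟩ := hK.1.isFacet_iff.1 hF
    refine hHK (hK.mem_of_subset_ordHull hFK hFc hHc fun x hx => ?_)
    exact mem_ordHull.2 ⟨q, hq, p, hp, hqc.trans (H.min'_le x hx), (H.le_max' x hx).trans hep⟩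
  have hstep : ∀ F G : {F : Finset (Fin n) // K.IsFacet F}, K.dualGraph.Adj F G →
      (∀ x ∈ F.1, x < e) → ∀ x ∈ G.1, x < e := by
    rintro ⟨F, hF⟩ ⟨G, hG⟩ ⟨-, E, -, hEF, hEG, hdF, -⟩ hFe
    refine (hside G hG).resolve_right fun hGc => ?_
    have hFc := (hK.1.isFacet_iff.1 hF).2
    have hE : E.card = d := by
      simp only [faceDim] at hdF
      omega
    -- The `d` shared vertices lie strictly between `c` and `e`; with these endpoints they would be
    -- `d + 2` elements of `H`.
    have hsub : insert c (insert e E) ⊆ H := by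
      intro x hx
      rw [hIcc, Finset.mem_Icc]
      simp only [Finset.mem_insert] at hx
      rcases hx with rfl | rfl | hx
      · exact ⟨le_rfl, hce.le⟩
      · exact ⟨hce.le, le_rfl⟩
      · exact ⟨(hGc x (hEG hx)).le, (hFe x (hEF hx)).le⟩
    have hcard := Finset.card_le_card hsub
    have he : e ∉ E := fun h => lt_irrefl _ (hFe e (hEF h))
    have hc : c ∉ insert e E := by
      rw [Finset.mem_insert, not_or]
      exact ⟨hce.ne, fun h => lt_irrefl _ (hGc c (hEG h))⟩
    rw [Finset.card_insert_of_notMem hc, Finset.card_insert_of_notMem he] at hcard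
    omega
  obtain ⟨F, hcF, hF⟩ := exists_isFacet_of_mem (hvert c)
  obtain ⟨G, heG, hG⟩ := exists_isFacet_of_mem (hvert e)
  rw [Finset.singleton_subset_iff] at hcF heG
  have hFe : ∀ x ∈ F, x < e := (hside F hF).resolve_right fun h => lt_irrefl _ (h c hcF)
  obtain ⟨w⟩ := hconn.preconnected ⟨F, hF⟩ ⟨G, hG⟩
  have hwalk : ∀ A B : {F : Finset (Fin n) // K.IsFacet F}, K.dualGraph.Walk A B →
      (∀ x ∈ A.1, x < e) → ∀ x ∈ B.1, x < e := by
    intro A B w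
    induction w with
    | nil => exact id
    | cons h _ ih => exact fun hA => ih (hstep _ _ h hA)
  exact lt_irrefl _ (hwalk _ _ w hFe e heG)

open Classical in
/-- The sorting key: members of `K` come first, then sets are compared by the size of their hull,
then by the colexicographic order. -/
noncomputable def shellingKey (K : PreAbstractSimplicialComplex (Fin n)) (F : Finset (Fin n)) :
    ℕ ×ₗ ℕ ×ₗ Colex (Finset (Fin n)) :=
  toLex (if F ∈ K then 0 else 1, toLex ((ordHull F).card, toColex F))

theorem shellingKey_injective (K : PreAbstractSimplicialComplex (Fin n)) :
    Function.Injective K.shellingKey := by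
  intro F G h
  simp only [shellingKey, EmbeddingLike.apply_eq_iff_eq, Prod.mk.injEq] at h
  exact h.2.2

theorem shellingKey_lt_of_mem_of_notMem {F G : Finset (Fin n)} (hF : F ∈ K) (hG : G ∉ K) :
    K.shellingKey F < K.shellingKey G := by
  simp [shellingKey, Prod.Lex.toLex_lt_toLex, hF, hG]

/-- The implication `hFH` ensures that the first coordinate of the key does not increase from `F` to
`H`. -/
theorem shellingKey_lt_of_card_lt {F H : Finset (Fin n)} (hFH : F ∈ K → H ∈ K)
    (h : (ordHull H).card < (ordHull F).card) : K.shellingKey H < K.shellingKey F := by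
  by_cases hF : F ∈ K <;> by_cases hH : H ∈ K <;>
    simp_all [shellingKey, Prod.Lex.toLex_lt_toLex]

theorem shellingKey_lt_of_colex_lt {F H : Finset (Fin n)} (hFH : F ∈ K → H ∈ K)
    (h : (ordHull H).card ≤ (ordHull F).card) (hc : toColex H < toColex F) :
    K.shellingKey H < K.shellingKey F := by
  by_cases hF : F ∈ K <;> by_cases hH : H ∈ K <;>
    simp_all [shellingKey, Prod.Lex.toLex_lt_toLex, h.lt_or_eq]

theorem mem_of_shellingKey_lt {F G : Finset (Fin n)} (h : K.shellingKey G < K.shellingKey F)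
    (hF : F ∈ K) : G ∈ K := by
  by_contra hG
  exact lt_asymm h (shellingKey_lt_of_mem_of_notMem hF hG)

theorem card_ordHull_le_of_shellingKey_lt {F G : Finset (Fin n)}
    (h : K.shellingKey G < K.shellingKey F) (hGF : G ∈ K → F ∈ K) :
    (ordHull G).card ≤ (ordHull F).card := by
  by_contra! hlt
  exact lt_asymm h (shellingKey_lt_of_card_lt hGF hlt)

theorem toColex_lt_of_shellingKey_lt {F G : Finset (Fin n)}
    (h : K.shellingKey G < K.shellingKey F) (hGF : G ∈ K → F ∈ K)
    (hc : (ordHull F).card ≤ (ordHull G).card) : toColex G < toColex F := by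
  rcases lt_trichotomy (toColex G) (toColex F) with h' | h' | h'
  · exact h'
  · exact absurd (toColex_inj.1 h' ▸ h) (lt_irrefl _)
  · exact absurd (shellingKey_lt_of_colex_lt hGF hc h') (lt_asymm h)

theorem toColex_insert_erase_lt {F : Finset (Fin n)} {x y : Fin n} (hx : x ∈ F) (hyx : y < x) :
    toColex (insert y (F.erase x)) < toColex F := by
  rw [Finset.Colex.toColex_lt_toColex_iff_exists_forall_lt]
  refine ⟨x, hx, by simp [hyx.ne'], fun b hb hbF => ?_⟩
  rcases Finset.mem_insert.1 hb with rfl | hb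
  · exact hyx
  · exact absurd (Finset.mem_of_mem_erase hb) hbF

theorem card_insert_erase {F : Finset (Fin n)} {x y : Fin n} (hx : x ∈ F) (hy : y ∉ F) :
    (insert y (F.erase x)).card = F.card := by
  rw [Finset.card_insert_of_notMem fun h => hy (Finset.mem_of_mem_erase h),
    Finset.card_erase_add_one hx]

/-- Moving an endpoint `x` of `F` into a gap `y` strictly shrinks the hull. -/
theorem IsUnitIntervalOrder.exists_exchange_of_notMem (hK : K.IsUnitIntervalOrder d)
    {F : Finset (Fin n)} (hFc : F.card = d + 1) {x y : Fin n} (hx : x ∈ F)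
    (hy : y ∈ ordHull F) (hyF : y ∉ F) (hend : x ∉ ordHull (insert y (F.erase x))) :
    ∃ H : Finset (Fin n), H.card = d + 1 ∧ K.shellingKey H < K.shellingKey F ∧ F.erase x ⊆ H := by
  have hHc := (card_insert_erase hx hyF).trans hFc
  have hsub : insert y (F.erase x) ⊆ ordHull F :=
    Finset.insert_subset hy ((Finset.erase_subset _ _).trans (subset_ordHull F))
  refine ⟨insert y (F.erase x), hHc, shellingKey_lt_of_card_lt
    (fun hF => hK.mem_of_subset_ordHull hF hFc hHc hsub) (Finset.card_lt_card ?_),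
    Finset.subset_insert _ _⟩
  exact (Finset.ssubset_iff_of_subset (ordHull_subset hsub)).2 ⟨x, subset_ordHull F hx, hend⟩

theorem IsUnitIntervalOrder.exists_exchange (hd : 0 < d) (hK : K.IsUnitIntervalOrder d)
    (hconn : K.IsStronglyConnected) (hvert : ∀ v, {v} ∈ K) {F G : Finset (Fin n)}
    (hFc : F.card = d + 1) (hGc : G.card = d + 1) (hlt : K.shellingKey G < K.shellingKey F) :
    ∃ x ∈ F, x ∉ G ∧ ∃ H : Finset (Fin n), H.card = d + 1 ∧
      K.shellingKey H < K.shellingKey F ∧ F.erase x ⊆ H := by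
  have hne : F.Nonempty := Finset.card_pos.1 (by omega)
  have hFmin := F.min'_mem hne
  have hFmax := F.max'_mem hne
  have hIcc := ordHull_eq_Icc hne
  by_cases hF : ordHull F = F
  · have hFK := hK.mem_of_ordHull_eq hd hconn hvert hFc hF
    have hle := card_ordHull_le_of_shellingKey_lt hlt fun _ => hFK
    have hG : G = ordHull G := Finset.eq_of_subset_of_card_le (subset_ordHull G) (by
      rw [hF] at hle
      omega)
    have hcol := toColex_lt_of_shellingKey_lt hlt (fun _ => hFK) (by rw [hF, ← hG]; omega)
    have hGne : G.Nonempty := Finset.card_pos.1 (by omega)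
    have hGIcc := hG.trans (ordHull_eq_Icc hGne)
    have hFIcc := hF.symm.trans hIcc
    obtain ⟨x, hxF, hxG, hx⟩ := Finset.Colex.toColex_lt_toColex_iff_exists_forall_lt.1 hcol
    set a := F.min' hne
    set b := F.max' hne
    set c := G.min' hGne
    set e := G.max' hGne
    have hcardF : (b : ℕ) + 1 - a = d + 1 := by rw [← hFc, hFIcc, Fin.card_Icc]
    have hcardG : (e : ℕ) + 1 - c = d + 1 := by rw [← hGc, hGIcc, Fin.card_Icc]
    have hxb : x ≤ b := F.le_max' x hxF
    -- Both sets are intervals of the same length, so colex order compares their right endpoints.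
    have heb : e < b := by
      by_contra! hbe
      rcases hbe.eq_or_lt with h | h
      · have hac : a = c := by
          rw [← h] at hcardG
          exact Fin.ext (by omega)
        exact hxG (by rwa [hGIcc, ← hac, ← h, ← hFIcc])
      · have heF : e ∉ F := fun h' => absurd (F.le_max' e h') (not_le.2 h)
        exact absurd (hx e (G.max'_mem hGne) heF) (not_lt.2 (hxb.trans hbe))
    have heb' : (e : ℕ) < b := heb
    have hac : (c : ℕ) < a := by omega
    -- Shift `F` one place left, dropping `b`, which is not in `G`. No truncation occurs in `a - 1`,
    -- as `c < a`.
    let y : Fin n := ⟨a - 1, by omega⟩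
    have hya : y < a := Fin.mk_lt_of_lt_val (by omega)
    have hab : a < b := Fin.lt_def.2 (by omega)
    have hyF : y ∉ F := fun h => absurd (F.min'_le y h) (not_le.2 hya)
    have hbF : b ∈ F := hFmax
    have hHc := (card_insert_erase hbF hyF).trans hFc
    set H := insert y (F.erase b) with hHdef
    have hHIcc : H ⊆ Finset.Icc y ⟨b - 1, by omega⟩ := by
      intro z hz
      rw [Finset.mem_Icc]
      rcases Finset.mem_insert.1 hz with rfl | hz
      · exact ⟨le_rfl, Fin.le_def.2 (by simp only [y]; omega)⟩
      · obtain ⟨hzb, hzF⟩ := Finset.mem_erase.1 hz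
        have h1 : a ≤ z := F.min'_le z hzF
        have h2 : (z : ℕ) < b := lt_of_le_of_ne (F.le_max' z hzF) (Fin.val_ne_of_ne hzb)
        exact ⟨(hya.trans_le h1).le, Fin.le_def.2 (by simp only; omega)⟩
    have hcardI : (Finset.Icc y (⟨b - 1, by omega⟩ : Fin n)).card = d + 1 := by
      rw [Fin.card_Icc]
      simp only [y]
      omega
    have hHeq : H = Finset.Icc y ⟨b - 1, by omega⟩ :=
      Finset.eq_of_subset_of_card_le hHIcc (by rw [hcardI, hHc])
    have hHhull : ordHull H = H := by
      refine Finset.Subset.antisymm (fun z hz => ?_) (subset_ordHull H)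
      obtain ⟨p, hp, q, hq, hpz, hzq⟩ := mem_ordHull.1 hz
      rw [hHeq, Finset.mem_Icc] at hp hq ⊢
      exact ⟨hp.1.trans hpz, hzq.trans hq.2⟩
    refine ⟨b, hbF, fun h => absurd (G.le_max' b h) (not_le.2 heb), H, hHc,
      shellingKey_lt_of_colex_lt (fun _ => hK.mem_of_ordHull_eq hd hconn hvert hHc hHhull) ?_
        (toColex_insert_erase_lt hbF (hya.trans hab)), Finset.subset_insert _ _⟩
    rw [hHhull, hF, hHc, hFc]
  · obtain ⟨y, hy, hyF⟩ : ∃ y ∈ ordHull F, y ∉ F := by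
      by_contra! h
      exact hF (Finset.Subset.antisymm h (subset_ordHull F))
    have hy' := hy
    rw [hIcc, Finset.mem_Icc] at hy'
    by_cases hmin : F.min' hne ∈ G
    swap
    · refine ⟨_, hFmin, hmin, hK.exists_exchange_of_notMem hFc hFmin hy hyF fun h => ?_⟩
      obtain ⟨p, hp, -, -, hpx, -⟩ := mem_ordHull.1 h
      rcases Finset.mem_insert.1 hp with rfl | hp
      · exact hyF (le_antisymm hpx hy'.1 ▸ hFmin)
      · obtain ⟨h1, h2⟩ := Finset.mem_erase.1 hp
        exact h1 (le_antisymm hpx (F.min'_le p h2))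
    by_cases hmax : F.max' hne ∈ G
    swap
    · refine ⟨_, hFmax, hmax, hK.exists_exchange_of_notMem hFc hFmax hy hyF fun h => ?_⟩
      obtain ⟨-, -, p, hp, -, hpx⟩ := mem_ordHull.1 h
      rcases Finset.mem_insert.1 hp with rfl | hp
      · exact hyF (le_antisymm hy'.2 hpx ▸ hFmax)
      · obtain ⟨h1, h2⟩ := Finset.mem_erase.1 hp
        exact h1 (le_antisymm (F.le_max' p h2) hpx)
    -- Now `G` contains both endpoints of `F`; being earlier, it has the same hull, so colex order
    -- decides.
    have hFG : F ⊆ ordHull G := fun z hz =>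
      mem_ordHull.2 ⟨_, hmin, _, hmax, F.min'_le z hz, F.le_max' z hz⟩
    have hsub := ordHull_subset hFG
    have hGF : G ∈ K → F ∈ K := fun h => hK.mem_of_subset_ordHull h hGc hFc hFG
    have heq : ordHull F = ordHull G :=
      Finset.eq_of_subset_of_card_le hsub (card_ordHull_le_of_shellingKey_lt hlt hGF)
    have hcol := toColex_lt_of_shellingKey_lt hlt hGF (Finset.card_le_card hsub)
    obtain ⟨x, hxF, hxG, hx⟩ := Finset.Colex.toColex_lt_toColex_iff_exists_forall_lt.1 hcol
    -- Any `z ∈ G \ F` is below `x`, so replacing `x` by `z` lowers the colex rank without enlarging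
    -- the hull.
    obtain ⟨z, hzG, hzF⟩ : ∃ z ∈ G, z ∉ F := by
      by_contra! h
      exact hxG (Finset.eq_of_subset_of_card_le h (by rw [hFc, hGc]) ▸ hxF)
    have hHc := (card_insert_erase hxF hzF).trans hFc
    have hH : insert z (F.erase x) ⊆ ordHull F :=
      Finset.insert_subset (heq ▸ subset_ordHull G hzG)
        ((Finset.erase_subset _ _).trans (subset_ordHull F))
    exact ⟨x, hxF, hxG, _, hHc, shellingKey_lt_of_colex_lt
      (fun h => hK.mem_of_subset_ordHull h hFc hHc hH) (Finset.card_le_card (ordHull_subset hH))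
      (toColex_insert_erase_lt hxF (hx z hzG hzF)), Finset.subset_insert _ _⟩

theorem IsUnitIntervalOrder.isShellingCompletable (hd : 0 < d) (hK : K.IsUnitIntervalOrder d)
    (hconn : K.IsStronglyConnected) (hvert : ∀ v, {v} ∈ K) : K.IsShellingCompletable d := by
  classical
  obtain ⟨F₀, hF₀⟩ := hK.1.1
  have hF₀c := (hK.1.isFacet_iff.1 hF₀).2
  obtain ⟨l, hl, hlp⟩ := exists_list_pairwise_lt
    ({F | F ∈ K ∧ F.card = d + 1} : Finset (Finset (Fin n))) K.shellingKey_injective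
  obtain ⟨l', hl', hlp'⟩ := exists_list_pairwise_lt
    ({F | F ∉ K ∧ F.card = d + 1} : Finset (Finset (Fin n))) K.shellingKey_injective
  simp only [Finset.mem_filter, Finset.mem_univ, true_and] at hl hl'
  have happ : ∀ F, F ∈ l ++ l' ↔ F.card = d + 1 := by
    intro F
    rw [List.mem_append, hl, hl']
    tauto
  refine ⟨l, l', isShelling_of_pairwise_lt hd hK.1 hl hlp ?_,
    isShelling_of_pairwise_lt hd (isPureOfDim_simplexSkeleton hF₀c) (fun F => ?_)
      (List.pairwise_append.2 ⟨hlp, hlp', fun F hF G hG =>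
        shellingKey_lt_of_mem_of_notMem ((hl F).1 hF).1 ((hl' G).1 hG).1⟩) ?_⟩
  · intro F hF G hG hlt
    obtain ⟨hFK, hFc⟩ := (hl F).1 hF
    obtain ⟨x, hxF, hxG, H, hHc, hHlt, hsub⟩ :=
      hK.exists_exchange hd hconn hvert hFc ((hl G).1 hG).2 hlt
    exact ⟨x, hxF, hxG, H, (hl H).2 ⟨mem_of_shellingKey_lt hHlt hFK, hHc⟩, hHlt, hsub⟩
  · rw [happ]
    refine ⟨fun h => ⟨⟨Finset.card_pos.1 (by omega), ?_⟩, h⟩, fun h => h.2⟩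
    unfold faceDim
    omega
  · intro F hF G hG hlt
    obtain ⟨x, hxF, hxG, H, hHc, hHlt, hsub⟩ :=
      hK.exists_exchange hd hconn hvert ((happ F).1 hF) ((happ G).1 hG) hlt
    exact ⟨x, hxF, hxG, H, (happ H).2 hHc, hHlt, hsub⟩

end UnitInterval

end PreAbstractSimplicialComplex

theorem corollary4p5 {n d : ℕ} (hd : 0 < d) (Δ : AbstractSimplicialComplex (Fin n))
    (hpure : Δ.IsPureOfDim d) (hconn : Δ.IsStronglyConnected) (hunit : Δ.IsUnitIntervalOrder d) :
    Δ.IsShellingCompletable d :=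
  hunit.isShellingCompletable hd hconn Δ.singleton_mem
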